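/- **Setting (continuous time).** Let $\mathcal X\subset\mathbb R^n$, $\mathcal U\subset\mathbb R^m$, $f:\mathcal X\times\mathcal U\to\mathbb R^n$, let $r:\mathcal X\times\mathcal U\to\mathbb R$ be measurable and bounded, $\tau>0$, $p\ge 0$, and let $X_F\subset\mathcal X$ be closed in $\mathcal X$. A trajectory from $x\in\mathcal X$ under $u:\mathcal X\to\mathcal U$ is a continuous $y:[0,\infty)\to\mathcal X$ with $y(0)=x$ and $\dot y(t)=f(y(t),u(y(t)))$ for every $t\ge0$ (right derivative). Let $\mathfrak U$ be the set of feedback controllers: measurable $u:\mathcal X\to\mathcal U$ whose trajectories are well defined for all time, that is, from every $x\in\mathcal X$ there is exactly one trajectory, denoted $\phi_x^u$. The set $X_F$ is absorbing: for $u\in\mathfrak U$, a trajectory $\phi^u_x$ starting in $x\in X_F$ stays in $X_F$. A controller $u$ is safe for $x$ if $\phi_x^u(t)\notin X_F$ for all $t\ge0$. The viability kernel $X_V$ is the set of $x\in\mathcal X$ for which some $u\in\mathfrak U$ is safe; $X_U=\mathcal X\setminus X_V$; and $\mathfrak U_{\rm safe}$ is the set of $u\in\mathfrak U$ that are safe for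 all $x\in X_V$. Put $$G(x,u)=\int_0^\infty e^{-t/\tau}\,r\big(\phi_x^u(t),u(\phi_x^u(t))\big)\,dt,\qquad \rho(x,u)=e^{-t_f/\tau},$$ where $t_f\in[0,\infty]$ is the first time at which $\phi_x^u$ is in $X_F$ ($\rho=0$ if $t_f=\infty$), and $$V_p(x)=\sup_{u\in\mathfrak U}\big(G(x,u)-p\,\rho(x,u)\big)\ (x\in\mathcal X),\qquad V(x)=\sup_{u\in\mathfrak U_{\rm safe}}G(x,u)\ (x\in X_V).$$ A controller $u\in\mathfrak U$ is an optimal controller of $V_p$ if $G(x,u)-p\rho(x,u)=V_p(x)$ for all $x\in\mathcal X$; assume that one exists. Let $\mu$ be a probability distribution with support in $X_V$. $V_p$ is a *safe value function* if each of its optimal controllers $u$ lies in $\mathfrak U_{\rm safe}$ and maximizes $\mathbb E_{x\sim\mu}[G(x,u)]$ over $\mathfrak U_{\rm safe}$. Let $$\alpha_{\inf}=\sup_{X_U}V_p,\qquad \alpha_{\sup}=\inf_{X_V}V$$ in $[-\infty,\infty]$; the *zeroth-order condition* is $\alpha_{\inf}<\alpha_{\sup}$. A *control barrier function* of a closed set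 $C$ on $D\supseteq C$ is a continuously differentiable $h:D\to\mathbb R$ such that $C=\{x\in D: h(x)\ge0\}$ and such that there is an extended class $\mathcal K_\infty$ function $\kappa$ (continuous, strictly increasing, $\kappa(0)=0$, $\kappa(s)\to\pm\infty$ as $s\to\pm\infty$) with $$\sup_{a\in\mathcal U}\ \nabla h(x)\cdot f(x,a)\ \ge\ -\kappa(h(x))\qquad\text{for all }x\in D.$$ **Proposition.** Let $V_p$ be a safe value function such that the zeroth-order condition holds. Assume that $f$ is continuous on $X_V\times\mathcal U$, that $V_{p|X_V}$ is continuously differentiable, that $X_V$ is compact, and that $\nabla V_{p|X_V}(x)\ne0$ for all $x$ in the boundary of $X_V$ in $\mathcal X$. Then, for all real $\alpha\in(\alpha_{\inf},\alpha_{\sup}]$, the function $h=V_{p|X_V}-\alpha$ is a control barrier function of $X_V$ (with $D=X_V$). -/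

import Mathlib

open Set Filter Topology MeasureTheory

noncomputable section

/-- Data of a continuous-time control problem with failure set: state set `X ⊆ ℝⁿ`, control set
`U ⊆ ℝᵐ`, dynamics `f`, reward `r`, discount rate `τ > 0` and a failure set `XF` that is closed
in `X`. Only the values of `f` and `r` on `X × U` matter. -/
structure ControlProblem (n m : ℕ) where
  X : Set (EuclideanSpace ℝ (Fin n))
  U : Set (EuclideanSpace ℝ (Fin m))
  f : EuclideanSpace ℝ (Fin n) → EuclideanSpace ℝ (Fin m) → EuclideanSpace ℝ (Fin n)
  r : EuclideanSpace ℝ (Fin n) → EuclideanSpace ℝ (Fin m) → ℝ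
  τ : ℝ
  XF : Set (EuclideanSpace ℝ (Fin n))
  τ_pos : 0 < τ
  r_measurable : Measurable (fun q : X × U => r q.1 q.2)
  r_bounded : ∃ M : ℝ, ∀ x ∈ X, ∀ a ∈ U, |r x a| ≤ M
  XF_closed : ∃ K : Set (EuclideanSpace ℝ (Fin n)), IsClosed K ∧ XF = X ∩ K

namespace ControlProblem

variable {n m : ℕ} (S : ControlProblem n m)

/-- `y` (on times `t ≥ 0`) is a trajectory from `x` under the feedback `u`: it is continuous,
stays in `X` and satisfies `ẏ(t) = f(y(t), u(y(t)))` at every `t ≥ 0`. As `u` may jump, and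
motion may stop when the failure set is hit, `ẏ` is the right derivative (which, for classical
solutions, is the derivative). -/
def IsTrajectory (u : EuclideanSpace ℝ (Fin n) → EuclideanSpace ℝ (Fin m))
    (x : EuclideanSpace ℝ (Fin n)) (y : ℝ → EuclideanSpace ℝ (Fin n)) : Prop :=
  y 0 = x ∧ ContinuousOn y (Ici 0) ∧
    ∀ t : ℝ, 0 ≤ t → y t ∈ S.X ∧ HasDerivWithinAt y (S.f (y t) (u (y t))) (Ici t) t

/-- The feedback controllers: measurable maps `X → U` whose trajectories are well defined for
all time, i.e. from every state of `X` there is exactly one trajectory. -/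
def controllers : Set (EuclideanSpace ℝ (Fin n) → EuclideanSpace ℝ (Fin m)) :=
  {u | MapsTo u S.X S.U ∧ Measurable (fun x : S.X => u x) ∧
    ∀ x ∈ S.X, ∃ y, S.IsTrajectory u x y ∧ ∀ z, S.IsTrajectory u x z → EqOn z y (Ici 0)}

open Classical in
/-- The trajectory from `x` under `u` (constant if there is none). -/
def flow (u : EuclideanSpace ℝ (Fin n) → EuclideanSpace ℝ (Fin m))
    (x : EuclideanSpace ℝ (Fin n)) : ℝ → EuclideanSpace ℝ (Fin n) :=
  if h : ∃ y, S.IsTrajectory u x y then h.choose else fun _ => x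

/-- The failure set is absorbing: trajectories that start in it remain in it. -/
def FailureAbsorbing : Prop :=
  ∀ u ∈ S.controllers, ∀ x ∈ S.XF, ∀ t : ℝ, 0 ≤ t → S.flow u x t ∈ S.XF

/-- `u` is safe for the point `x`: the trajectory from `x` never fails. -/
def SafeFor (u : EuclideanSpace ℝ (Fin n) → EuclideanSpace ℝ (Fin m))
    (x : EuclideanSpace ℝ (Fin n)) : Prop :=
  ∀ t : ℝ, 0 ≤ t → S.flow u x t ∉ S.XF

/-- The viability kernel. -/
def XV : Set (EuclideanSpace ℝ (Fin n)) :=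
  {x | x ∈ S.X ∧ ∃ u ∈ S.controllers, S.SafeFor u x}

/-- The unviability kernel. -/
def XU : Set (EuclideanSpace ℝ (Fin n)) := S.X \ S.XV

/-- The safe controllers: safe for every point of the viability kernel. -/
def safeControllers : Set (EuclideanSpace ℝ (Fin n) → EuclideanSpace ℝ (Fin m)) :=
  {u | u ∈ S.controllers ∧ ∀ x ∈ S.XV, S.SafeFor u x}

/-- The discounted return `G(x, u)`. -/
def ret (x : EuclideanSpace ℝ (Fin n))
    (u : EuclideanSpace ℝ (Fin n) → EuclideanSpace ℝ (Fin m)) : ℝ :=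
  ∫ t in Ioi (0 : ℝ), Real.exp (-t / S.τ) * S.r (S.flow u x t) (u (S.flow u x t))

/-- The time to failure (meaningful if the trajectory fails). -/
def failureTime (x : EuclideanSpace ℝ (Fin n))
    (u : EuclideanSpace ℝ (Fin n) → EuclideanSpace ℝ (Fin m)) : ℝ :=
  sInf {t : ℝ | 0 ≤ t ∧ S.flow u x t ∈ S.XF}

open Classical in
/-- The discounted risk `ρ(x, u)`: `exp (-t_f / τ)` with `t_f` the time to failure, `0` if the
trajectory never fails. -/
def risk (x : EuclideanSpace ℝ (Fin n))
    (u : EuclideanSpace ℝ (Fin n) → EuclideanSpace ℝ (Fin m)) : ℝ :=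
  if S.SafeFor u x then 0 else Real.exp (-S.failureTime x u / S.τ)

/-- The penalized value function `V_p`. -/
def Vp (p : ℝ) (x : EuclideanSpace ℝ (Fin n)) : ℝ :=
  sSup ((fun u => S.ret x u - p * S.risk x u) '' S.controllers)

/-- The constrained value function `V` (to be used on the viability kernel). -/
def V (x : EuclideanSpace ℝ (Fin n)) : ℝ :=
  sSup ((fun u => S.ret x u) '' S.safeControllers)

/-- `u` is an optimal controller of `V_p`: it attains the supremum at every state. -/
def IsOptimal (p : ℝ) (u : EuclideanSpace ℝ (Fin n) → EuclideanSpace ℝ (Fin m)) : Prop :=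
  u ∈ S.controllers ∧ ∀ x ∈ S.X, S.ret x u - p * S.risk x u = S.Vp p x

/-- `u` is optimal for the constrained problem `sup_{u safe} E_{x ∼ μ} [G(x, u)]`. -/
def IsConstrainedOptimal (μ : Measure (EuclideanSpace ℝ (Fin n)))
    (u : EuclideanSpace ℝ (Fin n) → EuclideanSpace ℝ (Fin m)) : Prop :=
  u ∈ S.safeControllers ∧
    ∀ w ∈ S.safeControllers, ∫ x, S.ret x w ∂μ ≤ ∫ x, S.ret x u ∂μ

/-- `V_p` is a safe value function: all of its optimal controllers are safe and optimal for the
constrained problem. -/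
def IsSafeValueFunction (μ : Measure (EuclideanSpace ℝ (Fin n))) (p : ℝ) : Prop :=
  ∀ u, S.IsOptimal p u → u ∈ S.safeControllers ∧ S.IsConstrainedOptimal μ u

/-- `sup V_p` over the unviability kernel (`⊥` if that is empty). -/
def alphaInf (p : ℝ) : EReal := ⨆ x ∈ S.XU, ((S.Vp p x : ℝ) : EReal)

/-- `inf V` over the viability kernel. -/
def alphaSup : EReal := ⨅ x ∈ S.XV, ((S.V x : ℝ) : EReal)

/-- The zeroth-order condition in continuous time. -/
def ZerothOrderCondition (p : ℝ) : Prop := S.alphaInf p < S.alphaSup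

end ControlProblem

/-- `h` is continuously differentiable on the set `D`, with gradient field `g`. (If `D` is thin,
`h` may have several such fields.) -/
def IsC1OnWithGradient {n : ℕ} (D : Set (EuclideanSpace ℝ (Fin n)))
    (h : EuclideanSpace ℝ (Fin n) → ℝ)
    (g : EuclideanSpace ℝ (Fin n) → EuclideanSpace ℝ (Fin n)) : Prop :=
  ContinuousOn g D ∧ ∀ x ∈ D, HasGradientWithinAt h (g x) D x

/-- Extended class `K∞` functions. -/
def IsExtendedClassKInf (κ : ℝ → ℝ) : Prop :=
  Continuous κ ∧ StrictMono κ ∧ κ 0 = 0 ∧ Tendsto κ atTop atTop ∧ Tendsto κ atBot atBot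

/-- `h : D → ℝ` is a control barrier function of the closed set `C ⊆ D` for the dynamics
`ẋ = f(x, u)`, `u ∈ U`: `h` is continuously differentiable on `D`, `C` is its `0`-superlevel set,
and for some extended class `K∞` function `κ` one has
`sup_{u ∈ U} ∇h(x) ⬝ f(x, u) ≥ - κ(h(x))` for all `x ∈ D`. -/
structure IsControlBarrierFunction {n m : ℕ}
    (f : EuclideanSpace ℝ (Fin n) → EuclideanSpace ℝ (Fin m) → EuclideanSpace ℝ (Fin n))
    (U : Set (EuclideanSpace ℝ (Fin m))) (C D : Set (EuclideanSpace ℝ (Fin n)))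
    (h : EuclideanSpace ℝ (Fin n) → ℝ) : Prop where
  isClosed : IsClosed C
  subset : C ⊆ D
  contDiff : ∃ g, IsC1OnWithGradient D h g
  superlevel : C = {x | x ∈ D ∧ 0 ≤ h x}
  barrier : ∀ g, IsC1OnWithGradient D h g → ∃ κ : ℝ → ℝ, IsExtendedClassKInf κ ∧
    ∀ x ∈ D, ((-κ (h x) : ℝ) : EReal) ≤ ⨆ a ∈ U, ((inner ℝ (g x) (f x a) : ℝ) : EReal)

end

/-! An optimal controller `u` of `V_p` is safe by assumption. Safe controllers carry no risk on
`X_V`, so `V ≤ V_p` there (`V_le_Vp`), and `α ≤ inf V` makes `h = V_p - α` nonnegative on `X_V`. A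
zero of `h` is thus a minimum over `X_V`. Tails of safe trajectories are safe, so the trajectory of
`u` stays in `X_V` and the right derivative of `h` along it is nonnegative at such a zero
(`inner_gradient_nonneg`).

Compactness extends this to all of `X_V` (`exists_barrier_rate`): for each `ε > 0` some `c ε ≥ 0`
gives `sup ∇h ⬝ f ≥ -(ε + c ε * h)`. The infimum of these affine bounds over `ε` vanishes at `0` and
yields `κ`. -/

section ClassKInf

/-- A family of affine bounds whose constant terms are arbitrarily small is dominated by a single
extended class `K∞` function. -/
theorem exists_isExtendedClassKInf_of_affine {c : ℝ → ℝ} (hc : ∀ ε, 0 < ε → 0 ≤ c ε) :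
    ∃ κ : ℝ → ℝ, IsExtendedClassKInf κ ∧
      ∀ s v : ℝ, 0 ≤ s → (∀ ε, 0 < ε → v ≤ ε + c ε * s) → v ≤ κ s := by
  let ψ : ℝ → ℝ := fun s => ⨅ ε : Ioi (0 : ℝ), ((ε : ℝ) + c ε * s)
  have nonneg : ∀ s, 0 ≤ s → ∀ ε : Ioi (0 : ℝ), 0 ≤ (ε : ℝ) + c ε * s := fun s hs ε =>
    add_nonneg (le_of_lt ε.2) (mul_nonneg (hc _ ε.2) hs)
  have bdd : ∀ s, 0 ≤ s → BddBelow (range fun ε : Ioi (0 : ℝ) => (ε : ℝ) + c ε * s) := by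
    intro s hs
    exact ⟨0, forall_mem_range.2 (nonneg s hs)⟩
  have : Nonempty (Ioi (0 : ℝ)) := ⟨⟨1, mem_Ioi.2 one_pos⟩⟩
  have ψ_nonneg : ∀ s, 0 ≤ s → 0 ≤ ψ s := fun s hs => le_ciInf (nonneg s hs)
  have ψ_le : ∀ s, 0 ≤ s → ∀ ε, 0 < ε → ψ s ≤ ε + c ε * s := fun s hs ε hε =>
    ciInf_le (bdd s hs) ⟨ε, hε⟩
  have ψ_zero : ψ 0 = 0 := by
    refine le_antisymm (le_of_forall_pos_le_add fun ε hε => ?_) (ψ_nonneg 0 le_rfl)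
    simpa using ψ_le 0 le_rfl ε hε
  have ψ_mono : ∀ s t, 0 ≤ s → s ≤ t → ψ s ≤ ψ t := by
    intro s t hs hst
    refine le_ciInf fun ε => (ψ_le s hs ε ε.2).trans ?_
    have := mul_le_mul_of_nonneg_left hst (hc _ ε.2)
    linarith
  -- As an infimum of affine functions, `ψ` is concave, hence continuous on the open half-line; only
  -- continuity at `0` needs the small constant terms.
  have ψ_concave : ConcaveOn ℝ (Ici 0) ψ := by
    refine ⟨convex_Ici 0, fun s hs t ht a b ha hb hab => le_ciInf fun ε => ?_⟩
    have h1 := mul_le_mul_of_nonneg_left (ψ_le s hs ε ε.2) ha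
    have h2 := mul_le_mul_of_nonneg_left (ψ_le t ht ε ε.2) hb
    simp only [smul_eq_mul]
    calc a * ψ s + b * ψ t ≤ a * (ε + c ε * s) + b * (ε + c ε * t) := add_le_add h1 h2
      _ = (a + b) * ε + c ε * (a * s + b * t) := by ring
      _ = ε + c ε * (a * s + b * t) := by rw [hab, one_mul]
  have ψ_cont : ContinuousOn ψ (Ici 0) := by
    intro s hs
    rcases eq_or_lt_of_le (show (0 : ℝ) ≤ s from hs) with rfl | hs'
    · rw [ContinuousWithinAt, ψ_zero, tendsto_order]
      refine ⟨fun a ha => ?_, fun a ha => ?_⟩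
      · filter_upwards [self_mem_nhdsWithin] with t ht using ha.trans_le (ψ_nonneg t ht)
      · have hlim : Tendsto (fun t => a / 2 + c (a / 2) * t) (𝓝[Ici 0] (0 : ℝ)) (𝓝 (a / 2)) := by
          have : Continuous fun t => a / 2 + c (a / 2) * t := by fun_prop
          simpa using (this.tendsto 0).mono_left nhdsWithin_le_nhds
        filter_upwards [self_mem_nhdsWithin, hlim.eventually_lt_const (half_lt_self ha)]
          with t ht h using (ψ_le t ht _ (half_pos ha)).trans_lt h
    · refine ((ψ_concave.continuousOn_interior).continuousAt ?_).continuousWithinAt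
      rw [interior_Ici]
      exact Ioi_mem_nhds hs'
  -- The summand `s` gives strict growth and both infinite limits. Truncation avoids negative
  -- arguments, where the affine family may be unbounded below.
  refine ⟨fun s => s + ψ (max s 0), ⟨?_, ?_, ?_, ?_, ?_⟩, fun s v hs hv => ?_⟩
  · exact continuous_id.add
      (ψ_cont.comp_continuous (by fun_prop) fun s => mem_Ici.2 (le_max_right s 0))
  · intro s t hst
    exact add_lt_add_of_lt_of_le hst
      (ψ_mono _ _ (le_max_right _ _) (max_le_max_right 0 hst.le))
  · simp [ψ_zero]
  · exact tendsto_atTop_mono (fun s => le_add_of_nonneg_right (ψ_nonneg _ (le_max_right _ _)))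
      tendsto_id
  · refine tendsto_id.congr' ?_
    filter_upwards [eventually_le_atBot (0 : ℝ)] with s hs
    simp [max_eq_right hs, ψ_zero]
  · simp only [max_eq_left hs]
    exact (le_ciInf fun ε : Ioi (0 : ℝ) => hv ε ε.2).trans (le_add_of_nonneg_left hs)

end ClassKInf

/-! ### The barrier inequality on a compact set -/

section Barrier

variable {n m : ℕ}

/-- On a compact set on which `h ≥ 0`, the barrier inequality follows from the existence, at each
zero of `h`, of a control along which `h` does not decrease. -/
theorem exists_barrier_rate {K : Set (EuclideanSpace ℝ (Fin n))} (hK : IsCompact K)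
    {U : Set (EuclideanSpace ℝ (Fin m))}
    {f : EuclideanSpace ℝ (Fin n) → EuclideanSpace ℝ (Fin m) → EuclideanSpace ℝ (Fin n)}
    (hf : ContinuousOn (fun q : EuclideanSpace ℝ (Fin n) × EuclideanSpace ℝ (Fin m) =>
      f q.1 q.2) (K ×ˢ U))
    {h : EuclideanSpace ℝ (Fin n) → ℝ} (hh : ContinuousOn h K) (h_nonneg : ∀ x ∈ K, 0 ≤ h x)
    {g : EuclideanSpace ℝ (Fin n) → EuclideanSpace ℝ (Fin n)} (hg : ContinuousOn g K)
    {u : EuclideanSpace ℝ (Fin n) → EuclideanSpace ℝ (Fin m)} (hu : MapsTo u K U)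
    (hzero : ∀ x ∈ K, h x = 0 → 0 ≤ inner ℝ (g x) (f x (u x))) :
    ∃ κ : ℝ → ℝ, IsExtendedClassKInf κ ∧ ∀ x ∈ K,
      ((-κ (h x) : ℝ) : EReal) ≤ ⨆ a ∈ U, ((inner ℝ (g x) (f x a) : ℝ) : EReal) := by
  have key : ∀ ε : ℝ, 0 < ε → ∃ c : ℝ, 0 ≤ c ∧ ∀ x ∈ K,
      ((-(ε + c * h x) : ℝ) : EReal) ≤ ⨆ a ∈ U, ((inner ℝ (g x) (f x a) : ℝ) : EReal) := by
    intro ε hε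
    -- Compact induction ranges over arbitrary sets `s`, so membership in `K` is carried separately.
    suffices H : ∃ c : ℝ, 0 ≤ c ∧ ∀ x ∈ K, x ∈ K →
        ((-(ε + c * h x) : ℝ) : EReal) ≤ ⨆ a ∈ U, ((inner ℝ (g x) (f x a) : ℝ) : EReal) by
      obtain ⟨c, hc, H⟩ := H
      exact ⟨c, hc, fun x hx => H x hx hx⟩
    refine hK.induction_on (p := fun s => ∃ c : ℝ, 0 ≤ c ∧ ∀ x ∈ s, x ∈ K →
      ((-(ε + c * h x) : ℝ) : EReal) ≤ ⨆ a ∈ U, ((inner ℝ (g x) (f x a) : ℝ) : EReal))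
      ⟨0, le_rfl, by simp⟩ ?_ ?_ ?_
    · rintro s t hst ⟨c, hc, H⟩
      exact ⟨c, hc, fun x hx => H x (hst hx)⟩
    · rintro s t ⟨c, hc, H⟩ ⟨d, hd, H'⟩
      refine ⟨max c d, hc.trans (le_max_left _ _), fun x hx hxK => ?_⟩
      have h0 := h_nonneg x hxK
      rcases hx with hx | hx
      · refine le_trans (EReal.coe_le_coe_iff.2 ?_) (H x hx hxK)
        gcongr
        exact le_max_left _ _
      · refine le_trans (EReal.coe_le_coe_iff.2 ?_) (H' x hx hxK)
        gcongr
        exact le_max_right _ _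
    · intro x₀ hx₀
      -- At a zero of `h` the hypothesis suffices with `c = 0`; elsewhere a large `c` absorbs the
      -- inner product.
      obtain ⟨c, hc, hlt⟩ : ∃ c : ℝ, 0 ≤ c ∧
          -ε < inner ℝ (g x₀) (f x₀ (u x₀)) + c * h x₀ := by
        rcases eq_or_lt_of_le (h_nonneg x₀ hx₀) with h0 | h0
        · refine ⟨0, le_rfl, ?_⟩
          have := hzero x₀ hx₀ h0.symm
          linarith
        · refine ⟨|inner ℝ (g x₀) (f x₀ (u x₀))| / h x₀, by positivity, ?_⟩
          rw [div_mul_cancel₀ _ h0.ne']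
          have := neg_abs_le (inner ℝ (g x₀) (f x₀ (u x₀)))
          linarith
      -- The control is frozen at `u x₀`: the feedback `u` need not be continuous.
      have hcont : ContinuousOn (fun x => inner ℝ (g x) (f x (u x₀)) + c * h x) K := by
        have hfu : ContinuousOn (fun x => f x (u x₀)) K :=
          hf.comp (f := fun x => (x, u x₀)) (by fun_prop) fun x hx => ⟨hx, hu hx₀⟩
        exact (hg.inner (𝕜 := ℝ) hfu).add (hh.const_mul c)
      refine ⟨{x | -ε < inner ℝ (g x) (f x (u x₀)) + c * h x},
        (hcont x₀ hx₀).eventually_const_lt hlt, c, hc, fun x hx _ => ?_⟩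
      refine le_trans (EReal.coe_le_coe_iff.2 ?_)
        (le_iSup₂ (f := fun a (_ : a ∈ U) => ((inner ℝ (g x) (f x a) : ℝ) : EReal))
          (u x₀) (hu hx₀))
      have : -ε < inner ℝ (g x) (f x (u x₀)) + c * h x := hx
      linarith
  choose! c hc hbound using key
  obtain ⟨κ, hκ, hdom⟩ := exists_isExtendedClassKInf_of_affine hc
  refine ⟨κ, hκ, fun x hx => ?_⟩
  have hF : ∀ ε, 0 < ε → ((-(ε + c ε * h x) : ℝ) : EReal) ≤
      ⨆ a ∈ U, ((inner ℝ (g x) (f x a) : ℝ) : EReal) := fun ε hε => hbound ε hε x hx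
  generalize (⨆ a ∈ U, ((inner ℝ (g x) (f x a) : ℝ) : EReal)) = F at hF ⊢
  induction F with
  | bot => exact absurd (hF 1 one_pos) (EReal.bot_lt_coe _).not_ge
  | top => exact le_top
  | coe v =>
    refine EReal.coe_le_coe_iff.2 (neg_le.1 (hdom _ _ (h_nonneg x hx) fun ε hε => ?_))
    exact neg_le.1 (EReal.coe_le_coe_iff.1 (hF ε hε))

end Barrier

/-- Subtracting a constant does not change gradient fields. -/
theorem IsC1OnWithGradient.sub_const {n : ℕ} {D : Set (EuclideanSpace ℝ (Fin n))}
    {h : EuclideanSpace ℝ (Fin n) → ℝ} {g : EuclideanSpace ℝ (Fin n) → EuclideanSpace ℝ (Fin n)}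
    (H : IsC1OnWithGradient D h g) (c : ℝ) : IsC1OnWithGradient D (fun x => h x - c) g :=
  ⟨H.1, fun x hx => (H.2 x hx).hasFDerivWithinAt.sub_const c⟩

/-! ### Trajectories, values and invariance of the viability kernel -/

namespace ControlProblem

variable {n m : ℕ} {S : ControlProblem n m}
  {u : EuclideanSpace ℝ (Fin n) → EuclideanSpace ℝ (Fin m)}
  {x : EuclideanSpace ℝ (Fin n)} {y : ℝ → EuclideanSpace ℝ (Fin n)}

theorem isTrajectory_flow (hu : u ∈ S.controllers) (hx : x ∈ S.X) :
    S.IsTrajectory u x (S.flow u x) := by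
  have h : ∃ y, S.IsTrajectory u x y := (hu.2.2 x hx).imp fun _ hy => hy.1
  rw [flow, dif_pos h]
  exact h.choose_spec

theorem IsTrajectory.eqOn_flow (hu : u ∈ S.controllers) (hx : x ∈ S.X)
    (hy : S.IsTrajectory u x y) : EqOn y (S.flow u x) (Ici 0) := by
  obtain ⟨z, -, hz⟩ := hu.2.2 x hx
  exact (hz y hy).trans (hz _ (isTrajectory_flow hu hx)).symm

/-- Under a feedback law the dynamics are autonomous, so time can be restarted at `s`. -/
theorem IsTrajectory.shift (hy : S.IsTrajectory u x y) {s : ℝ} (hs : 0 ≤ s) :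
    S.IsTrajectory u (y s) fun t => y (s + t) := by
  refine ⟨by simp, hy.2.1.comp (by fun_prop) fun t ht => ?_, fun t ht => ?_⟩
  · exact mem_Ici.2 (add_nonneg hs ht)
  · obtain ⟨hX, hd⟩ := hy.2.2 (s + t) (add_nonneg hs ht)
    refine ⟨hX, ?_⟩
    have hmaps : MapsTo (fun t => s + t) (Ici t) (Ici (s + t)) := fun r hr =>
      mem_Ici.2 (add_le_add_right hr s)
    have := hd.scomp t ((hasDerivWithinAt_id t (Ici t)).const_add s) hmaps
    simpa [Function.comp_def] using this

/-- Safe trajectories remain in the viability kernel. -/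
theorem SafeFor.flow_mem_XV (hu : u ∈ S.controllers) (hx : x ∈ S.X) (hsafe : S.SafeFor u x)
    {s : ℝ} (hs : 0 ≤ s) : S.flow u x s ∈ S.XV := by
  have hy := isTrajectory_flow hu hx
  have hX := (hy.2.2 s hs).1
  -- The same controller is the witness: by uniqueness, its trajectory from the point reached at
  -- time `s` is the tail of the original one.
  refine ⟨hX, u, hu, fun t ht => ?_⟩
  rw [← (hy.shift hs).eqOn_flow hu hX ht]
  exact hsafe _ (add_nonneg hs ht)

theorem risk_nonneg : 0 ≤ S.risk x u := by
  unfold risk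
  split_ifs
  exacts [le_rfl, (Real.exp_pos _).le]

/-- The discounted return is bounded uniformly in the controller. -/
theorem exists_ret_le (S : ControlProblem n m) :
    ∃ B : ℝ, ∀ u ∈ S.controllers, ∀ x ∈ S.X, S.ret x u ≤ B := by
  obtain ⟨M, hM⟩ := S.r_bounded
  refine ⟨∫ t in Ioi (0 : ℝ), Real.exp (-t / S.τ) * M, fun u hu x hx => ?_⟩
  have hint : IntegrableOn (fun t : ℝ => Real.exp (-t / S.τ) * M) (Ioi 0) := by
    have := integrableOn_exp_mul_Ioi (a := -S.τ⁻¹) (by simpa using S.τ_pos) 0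
    refine Integrable.mul_const (this.congr_fun (fun t _ => ?_) measurableSet_Ioi) M
    simp only [div_eq_mul_inv]
    ring_nf
  refine (Real.le_norm_self _).trans (norm_integral_le_of_norm_le hint ?_)
  filter_upwards [self_mem_ae_restrict measurableSet_Ioi] with t ht
  have hX := ((isTrajectory_flow hu hx).2.2 t (le_of_lt ht)).1
  rw [norm_mul, Real.norm_eq_abs, Real.norm_eq_abs, Real.abs_exp]
  exact mul_le_mul_of_nonneg_left (hM _ hX _ (hu.1 hX)) (Real.exp_pos _).le

/-- Needed because a real `sSup` is an upper bound only for sets bounded above; the penalty can only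
lower the return. -/
theorem bddAbove_penalized {p : ℝ} (hp : 0 ≤ p) (hx : x ∈ S.X) :
    BddAbove ((fun u => S.ret x u - p * S.risk x u) '' S.controllers) := by
  obtain ⟨B, hB⟩ := S.exists_ret_le
  refine ⟨B, ?_⟩
  rintro _ ⟨u, hu, rfl⟩
  have := mul_nonneg hp (risk_nonneg (S := S) (x := x) (u := u))
  have := hB u hu x hx
  dsimp only
  linarith

/-- The constrained value is at most the penalized value. -/
theorem V_le_Vp {p : ℝ} (hp : 0 ≤ p) (hne : S.safeControllers.Nonempty) (hx : x ∈ S.XV) :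
    S.V x ≤ S.Vp p x := by
  refine csSup_le (hne.image _) ?_
  rintro _ ⟨w, hw, rfl⟩
  refine le_csSup (bddAbove_penalized hp hx.1) ⟨w, hw.1, ?_⟩
  simp [risk, hw.2 x hx]

/-- A function that is minimal at `x` over the viability kernel does not decrease along the
velocity of a safe trajectory from `x`. -/
theorem inner_gradient_nonneg (hu : u ∈ S.safeControllers) (hx : x ∈ S.XV)
    {h : EuclideanSpace ℝ (Fin n) → ℝ} {v : EuclideanSpace ℝ (Fin n)}
    (hv : HasGradientWithinAt h v S.XV x) (hmin : ∀ z ∈ S.XV, h x ≤ h z) :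
    0 ≤ inner ℝ v (S.f x (u x)) := by
  have hy := isTrajectory_flow hu.1 hx.1
  have hmaps : MapsTo (S.flow u x) (Ici 0) S.XV := fun s hs =>
    (hu.2 x hx).flow_mem_XV hu.1 hx.1 hs
  have hd := (hy.2.2 0 le_rfl).2
  have hv' := hv.hasFDerivWithinAt
  rw [← hy.1] at hv'
  have hcomp := hv'.comp_hasDerivWithinAt (0 : ℝ) hd hmaps
  rw [hasDerivWithinAt_iff_tendsto_slope, Ici_sdiff_left] at hcomp
  -- The difference quotients at `t > 0` are nonnegative, as the trajectory stays where `h` is at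
  -- least `h x`.
  have hlim : 0 ≤ (InnerProductSpace.toDual ℝ (EuclideanSpace ℝ (Fin n)) v)
      (S.f (S.flow u x 0) (u (S.flow u x 0))) := by
    refine ge_of_tendsto hcomp ?_
    filter_upwards [self_mem_nhdsWithin] with t ht
    rw [slope_def_field]
    refine div_nonneg (sub_nonneg.2 ?_) (sub_nonneg.2 (le_of_lt ht))
    simpa [hy.1] using hmin _ (hmaps (mem_Ici.2 (le_of_lt ht)))
  simpa [hy.1] using hlim

end ControlProblem

theorem proposition4 {n m : ℕ} (S : ControlProblem n m)
    (μ : Measure (EuclideanSpace ℝ (Fin n))) [IsProbabilityMeasure μ]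
    (hμ : μ.support ⊆ S.XV)
    (p : ℝ) (hp : 0 ≤ p)
    (habs : S.FailureAbsorbing)
    (hf : ContinuousOn (fun q : EuclideanSpace ℝ (Fin n) × EuclideanSpace ℝ (Fin m) =>
      S.f q.1 q.2) (S.XV ×ˢ S.U))
    (hatt : ∃ u, S.IsOptimal p u)
    (hsafe : S.IsSafeValueFunction μ p)
    (hzero : S.ZerothOrderCondition p)
    (hcompact : IsCompact S.XV)
    (g : EuclideanSpace ℝ (Fin n) → EuclideanSpace ℝ (Fin n))
    (hC1 : IsC1OnWithGradient S.XV (S.Vp p) g)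
    (hgrad : ∀ x ∈ S.XV ∩ closure S.XU, g x ≠ 0)
    (α : ℝ) (hα : S.alphaInf p < (α : EReal)) (hα' : (α : EReal) ≤ S.alphaSup) :
    IsControlBarrierFunction S.f S.U S.XV S.XV (fun x => S.Vp p x - α) := by
  obtain ⟨u, hu⟩ := hatt
  have hus : u ∈ S.safeControllers := (hsafe u hu).1
  have hnonneg : ∀ x ∈ S.XV, 0 ≤ S.Vp p x - α := fun x hx =>
    sub_nonneg.2 ((EReal.coe_le_coe_iff.1 (hα'.trans (iInf₂_le x hx))).trans
      (ControlProblem.V_le_Vp hp ⟨u, hus⟩ hx))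
  refine ⟨hcompact.isClosed, subset_rfl, ⟨g, hC1.sub_const α⟩, ?_, fun g' hg' => ?_⟩
  · ext x
    exact ⟨fun hx => ⟨hx, hnonneg x hx⟩, fun hx => hx.1⟩
  -- The argument uses only differentiability within `X_V` and continuity of the field, so it
  -- applies to every gradient field `g'`.
  · refine exists_barrier_rate hcompact hf
      (fun x hx => (hg'.2 x hx).hasFDerivWithinAt.continuousWithinAt) hnonneg hg'.1
      (fun x hx => hus.1.1 hx.1) fun x hx h0 => ?_
    exact ControlProblem.inner_gradient_nonneg hus hx (hg'.2 x hx) fun z hz =>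
      h0.trans_le (hnonneg z hz)
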